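/- For $\alpha>-1$ and $n=0,1,2,\dots$ let $L^{(\alpha)}_n$ be the Laguerre polynomial, i.e. the polynomial of degree $n$ with leading coefficient of sign $(-1)^n$ such that $$\int_0^\infty e^{-x}x^\alpha L^{(\alpha)}_m(x)L^{(\alpha)}_n(x)\,\mathrm{d}x=\Gamma(\alpha+1)\binom{n+\alpha}{n}\delta_{nm},$$ explicitly $L^{(\alpha)}_n(x)=\sum_{k=0}^n\frac{(-1)^k}{k!}\binom{n+\alpha}{n-k}x^k$. Let $\widehat L^{(\alpha)}_n=(-1)^n\,n!\,L^{(\alpha)}_n$ be its monic normalization, with $\widehat L^{(\alpha)}_{-1}=0$. For real $t$ define the polynomial of degree $n+1$ $$\widehat L^{(\alpha)}_{n+1}(x,t)=\bigl(x-(2n+\alpha+1)\bigr)\widehat L^{(\alpha)}_n(x)-n(n+\alpha)\,t^2\,\widehat L^{(\alpha)}_{n-1}(x).$$ Then for all real $\alpha$ with $-1<\alpha\le 47.9603$ and all integers $n\ge 5$, the following holds: for every $t\in[0,0.568774]$ all zeros of $\widehat L^{(\alpha)}_{n+1}(\cdot,t)$ are real, and the product of its smallest and largest zeros is a strictly increasing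 function of $t$ on $[0,0.568774]$. -/

import Mathlib

open Polynomial

noncomputable section

/-- The Laguerre polynomial
`L_n^(α)(x) = ∑_{k ≤ n} (-1)^k * binom (n + α) (n - k) * x^k / k!`, as a real polynomial. -/
def laguerreL (α : ℝ) (n : ℕ) : ℝ[X] :=
  ∑ k ∈ Finset.range (n + 1),
    C ((-1) ^ k * Ring.choose ((n : ℝ) + α) (n - k) / (k.factorial : ℝ)) * X ^ k

/-- The normalized polynomial `(-1)^n * n! * L_n^(α)`, which is monic. -/
def laguerreHat (α : ℝ) (n : ℕ) : ℝ[X] :=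
  C ((-1) ^ n * (n.factorial : ℝ)) * laguerreL α n

/-- The interpolating polynomial of degree `n + 1` with parameter `t`,
`(x - (2n + α + 1)) * M_n(x) - n * (n + α) * t^2 * M_{n-1}(x)`, where `M_k = laguerreHat α k`.
For `n = 0` the last term vanishes because of the factor `n`, in accordance with `M_{-1} = 0`. -/
def laguerreInterp (α : ℝ) (n : ℕ) (t : ℝ) : ℝ[X] :=
  (X - C (2 * (n : ℝ) + α + 1)) * laguerreHat α n
    - C ((n : ℝ) * ((n : ℝ) + α) * t ^ 2) * laguerreHat α (n - 1)

/-- The smallest real zero of `p` (meaningful when the set of real zeros has a least element). -/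
def smallestZero (p : ℝ[X]) : ℝ := sInf {x : ℝ | p.IsRoot x}

/-- The largest real zero of `p` (meaningful when the set of real zeros has a greatest element). -/
def largestZero (p : ℝ[X]) : ℝ := sSup {x : ℝ | p.IsRoot x}

/-! The explicit polynomials above are the Laguerre polynomials in the sense of the usual
orthogonality conditions: degree, sign of the leading coefficient, and orthogonality. -/

theorem laguerreL_coeff (α : ℝ) (n k : ℕ) :
    (laguerreL α n).coeff k =
      if k ≤ n then (-1) ^ k * Ring.choose ((n : ℝ) + α) (n - k) / (k.factorial : ℝ) else 0 := by
  simp only [laguerreL, finsetSum_coeff, coeff_C_mul_X_pow]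
  rw [Finset.sum_ite_eq]
  simp

theorem laguerreL_natDegree (α : ℝ) (n : ℕ) : (laguerreL α n).natDegree = n := by
  refine natDegree_eq_of_le_of_coeff_ne_zero ?_ ?_
  · rw [natDegree_le_iff_coeff_eq_zero]
    intro k hk
    rw [laguerreL_coeff, if_neg (by omega)]
  · rw [laguerreL_coeff, if_pos le_rfl]
    simp [Nat.factorial_ne_zero]

theorem laguerreL_leadingCoeff (α : ℝ) (n : ℕ) :
    (laguerreL α n).leadingCoeff = (-1) ^ n / (n.factorial : ℝ) := by
  rw [leadingCoeff, laguerreL_natDegree, laguerreL_coeff, if_pos le_rfl]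
  simp

theorem gamma_mul_ascPochhammer {s : ℝ} (hs : 0 < s) (m : ℕ) :
    Real.Gamma (s + m) = (ascPochhammer ℝ m).eval s * Real.Gamma s := by
  induction m with
  | zero => simp
  | succ m ih =>
    rw [ascPochhammer_succ_eval, Nat.cast_succ, ← add_assoc,
      Real.Gamma_add_one (by positivity), ih]
    ring

theorem choose_mul_gamma {s : ℝ} (hs : 0 < s) (m : ℕ) :
    Ring.choose (s + m - 1) m * Real.Gamma s = Real.Gamma (s + m) / (m.factorial : ℝ) := by
  rw [Ring.choose_eq_smul, descPochhammer_smeval_eq_ascPochhammer, ascPochhammer_smeval_eq_eval,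
    gamma_mul_ascPochhammer hs, smul_eq_mul]
  have : s + (m : ℝ) - 1 - m + 1 = s := by ring
  rw [this]
  ring

theorem laguerreL_moment {α : ℝ} (hα : -1 < α) {n j : ℕ} (hj : j ≤ n) :
    ∑ k ∈ Finset.range (n + 1), (laguerreL α n).coeff k * Real.Gamma (α + 1 + (j + k : ℕ)) =
      if j = n then (-1) ^ n * Real.Gamma (α + 1 + n) else 0 := by
  set P : ℝ[X] := (ascPochhammer ℝ j).comp (X + C (α + 1)) with hP
  have hdeg : P.natDegree = j := by
    rw [hP, natDegree_comp, ascPochhammer_natDegree, natDegree_X_add_C, mul_one]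
  have hlead : P.leadingCoeff = 1 :=
    (monic_ascPochhammer ℝ j).comp_X_add_C _
  have h1 : ∀ k ∈ Finset.range (n + 1),
      (laguerreL α n).coeff k * Real.Gamma (α + 1 + (j + k : ℕ)) =
        (-1) ^ n * (Real.Gamma (α + 1 + n) / (n.factorial : ℝ)) *
          ((((-1) ^ (n - k) * (n.choose k : ℤ) : ℤ)) • P.eval (0 + k • (1 : ℝ))) := by
    intro k hk
    have hk : k ≤ n := by simpa [Nat.lt_succ_iff] using hk
    have hs : 0 < α + 1 + k := by have : (0 : ℝ) ≤ k := k.cast_nonneg; linarith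
    have e1 : α + 1 + ((j + k : ℕ) : ℝ) = (α + 1 + k) + j := by push_cast; ring
    have e2 := choose_mul_gamma hs (n - k)
    have e3 : α + 1 + (k : ℝ) + ((n - k : ℕ) : ℝ) = α + 1 + n := by
      rw [Nat.cast_sub hk]; ring
    have e4 : α + 1 + (n : ℝ) - 1 = n + α := by ring
    rw [e3, e4] at e2
    have e5 : P.eval (0 + k • (1 : ℝ)) = (ascPochhammer ℝ j).eval (α + 1 + k) := by
      rw [hP, eval_comp]; congr 1; simp; ring
    have e6 : ((-1 : ℝ)) ^ n * (-1) ^ (n - k) = (-1) ^ k := by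
      obtain ⟨m, rfl⟩ := Nat.exists_eq_add_of_le hk
      rw [Nat.add_sub_cancel_left, pow_add, mul_assoc, ← mul_pow]; simp
    have e7 : ((n.choose k : ℝ)) / n.factorial = 1 / (k.factorial * (n - k).factorial) := by
      rw [Nat.cast_choose ℝ hk]
      have := Nat.factorial_ne_zero n
      field_simp
    rw [laguerreL_coeff, if_pos hk, e1, gamma_mul_ascPochhammer hs, e5, zsmul_eq_mul]
    push_cast
    calc _ = (-1) ^ k / (k.factorial : ℝ) * (ascPochhammer ℝ j).eval (α + 1 + k) *
          (Ring.choose ((n : ℝ) + α) (n - k) * Real.Gamma (α + 1 + k)) := by ring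
      _ = (-1) ^ k * (1 / ((k.factorial : ℝ) * (n - k).factorial)) *
            (ascPochhammer ℝ j).eval (α + 1 + k) * Real.Gamma (α + 1 + n) := by
          rw [e2]; field_simp
      _ = _ := by rw [← e6, ← e7]; ring
  rw [Finset.sum_congr rfl h1, ← Finset.mul_sum,
    ← fwdDiff_iter_eq_sum_shift (1 : ℝ) (fun x => P.eval x) n 0]
  split_ifs with h
  · have := fwdDiff_iter_degree_eq_factorial P
    rw [hdeg, hlead, h] at this
    rw [this]
    have := Nat.factorial_ne_zero n
    simp
    field_simp
  · have := fwdDiff_iter_eq_zero_of_degree_lt (P := P) (n := n) (by omega)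
    rw [this]
    simp

theorem weight_moment {α : ℝ} (hα : -1 < α) (j : ℕ) :
    MeasureTheory.IntegrableOn (fun x : ℝ => Real.exp (-x) * x ^ α * x ^ j) (Set.Ioi 0) ∧
    ∫ x in Set.Ioi (0 : ℝ), Real.exp (-x) * x ^ α * x ^ j = Real.Gamma (α + 1 + j) := by
  have hs : 0 < α + 1 + j := by have : (0 : ℝ) ≤ j := j.cast_nonneg; linarith
  have he : Set.EqOn (fun x : ℝ => Real.exp (-x) * x ^ (α + 1 + j - 1))
      (fun x : ℝ => Real.exp (-x) * x ^ α * x ^ j) (Set.Ioi 0) := by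
    intro x hx
    have hx : 0 < x := hx
    have : α + 1 + (j : ℝ) - 1 = α + j := by ring
    simp only [this, Real.rpow_add hx, Real.rpow_natCast]
    ring
  refine ⟨(Real.GammaIntegral_convergent hs).congr_fun he measurableSet_Ioi, ?_⟩
  rw [Real.Gamma_eq_integral hs]
  exact (MeasureTheory.setIntegral_congr_fun measurableSet_Ioi he).symm

theorem weight_integrable {α : ℝ} (hα : -1 < α) (p : ℝ[X]) :
    MeasureTheory.IntegrableOn (fun x : ℝ => Real.exp (-x) * x ^ α * p.eval x) (Set.Ioi 0) := by
  have : (fun x : ℝ => Real.exp (-x) * x ^ α * p.eval x) = fun x =>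
      ∑ i ∈ Finset.range (p.natDegree + 1), p.coeff i * (Real.exp (-x) * x ^ α * x ^ i) := by
    funext x
    rw [eval_eq_sum_range, Finset.mul_sum]
    exact Finset.sum_congr rfl fun i _ => by ring
  rw [this]
  exact MeasureTheory.integrable_finsetSum _ fun i _ => ((weight_moment hα i).1).const_mul _

theorem laguerreL_orthogonal_of_le {α : ℝ} (hα : -1 < α) {m n : ℕ} (hmn : m ≤ n) :
    ∫ x in Set.Ioi (0 : ℝ),
        Real.exp (-x) * x ^ α * ((laguerreL α m).eval x * (laguerreL α n).eval x) =
      if m = n then Real.Gamma (α + 1) * Ring.choose ((n : ℝ) + α) n else 0 := by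
  have h : (fun x : ℝ => Real.exp (-x) * x ^ α *
      ((laguerreL α m).eval x * (laguerreL α n).eval x)) = fun x =>
      ∑ j ∈ Finset.range (m + 1), ∑ k ∈ Finset.range (n + 1),
        ((laguerreL α m).coeff j * (laguerreL α n).coeff k) *
          (Real.exp (-x) * x ^ α * x ^ (j + k)) := by
    funext x
    rw [eval_eq_sum_range, eval_eq_sum_range, laguerreL_natDegree, laguerreL_natDegree,
      Finset.sum_mul_sum, Finset.mul_sum]
    refine Finset.sum_congr rfl fun j _ => ?_
    rw [Finset.mul_sum]
    exact Finset.sum_congr rfl fun k _ => by ring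
  have hint : ∀ (c : ℝ) (i : ℕ), MeasureTheory.Integrable
      (fun x : ℝ => c * (Real.exp (-x) * x ^ α * x ^ i))
      (MeasureTheory.volume.restrict (Set.Ioi 0)) :=
    fun c i => ((weight_moment hα i).1).const_mul _
  rw [h, MeasureTheory.integral_finsetSum _ fun j _ =>
    MeasureTheory.integrable_finsetSum _ fun k _ => hint _ _]
  have h2 : ∀ j ∈ Finset.range (m + 1),
      ∫ x in Set.Ioi (0 : ℝ), ∑ k ∈ Finset.range (n + 1),
        ((laguerreL α m).coeff j * (laguerreL α n).coeff k) *
          (Real.exp (-x) * x ^ α * x ^ (j + k)) =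
      if j = n then (laguerreL α m).coeff n * ((-1) ^ n * Real.Gamma (α + 1 + n)) else 0 := by
    intro j hj
    have hj : j ≤ n := by have := Finset.mem_range.1 hj; omega
    rw [MeasureTheory.integral_finsetSum _ fun k _ => hint _ _]
    have := laguerreL_moment hα hj
    simp only [MeasureTheory.integral_const_mul, (weight_moment hα _).2]
    simp only [mul_assoc]
    rw [← Finset.mul_sum, this]
    split_ifs with h
    · rw [h]
    · simp
  rw [Finset.sum_congr rfl h2, Finset.sum_ite_eq']
  have hG := choose_mul_gamma (s := α + 1) (by linarith) n
  have e : α + 1 + (n : ℝ) - 1 = n + α := by ring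
  rw [e] at hG
  by_cases hm : m = n
  · subst hm
    rw [if_pos (by simp), if_pos rfl, laguerreL_coeff, if_pos le_rfl, mul_comm (Real.Gamma _), hG]
    have : ((-1 : ℝ)) ^ m * (-1) ^ m = 1 := by rw [← mul_pow]; simp
    simp only [Nat.sub_self, Ring.choose_zero_right, mul_one]
    calc _ = ((-1 : ℝ) ^ m * (-1) ^ m) * (Real.Gamma (α + 1 + m) / m.factorial) := by ring
      _ = _ := by rw [this, one_mul]
  · rw [if_neg (by simp; omega), if_neg hm]

/-- The conditions `∫_0^∞ e^{-x} x^α L_m(x) L_n(x) dx = Γ(α+1) * binom (n+α) n * δ_{nm}`. -/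
theorem laguerreL_orthogonality {α : ℝ} (hα : -1 < α) (m n : ℕ) :
    MeasureTheory.IntegrableOn (fun x : ℝ =>
        Real.exp (-x) * x ^ α * ((laguerreL α m).eval x * (laguerreL α n).eval x)) (Set.Ioi 0) ∧
    ∫ x in Set.Ioi (0 : ℝ),
        Real.exp (-x) * x ^ α * ((laguerreL α m).eval x * (laguerreL α n).eval x) =
      if m = n then Real.Gamma (α + 1) * Ring.choose ((n : ℝ) + α) n else 0 := by
  refine ⟨by simpa using weight_integrable hα (laguerreL α m * laguerreL α n), ?_⟩
  rcases le_total m n with h | h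
  · exact laguerreL_orthogonal_of_le hα h
  · have := laguerreL_orthogonal_of_le hα h
    simp only [mul_comm ((laguerreL α n).eval _)] at this
    rw [this]
    by_cases hmn : m = n
    · subst hmn; rfl
    · rw [if_neg hmn, if_neg (Ne.symm hmn)]

end

noncomputable section

/-! ### The three-term recurrence of the monic Laguerre polynomials -/

/-! Put `s = t ^ 2`, `b = 2n + α + 1`, `a = n (n + α)`, and let `M k` be the monic Laguerre
polynomials. A zero `x = b + z` of the interpolating polynomial satisfies `z * M n x = a * s * M
(n-1) x`, so the zeros move with `s` along the level sets of one rational function, `levelFun`.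

By the three-term recurrence, `M n / M (n-1)` is a continued fraction. It maps the upper half-plane
into itself, so all zeros are real (`laguerreInterp_splits`). To the right of its poles and zeros it
increases with slope at least 1, so the largest zero `b + Y` is the outermost solution of the
equation above and is continuous in `s` (`IsTopSol`). The reflection `z ↦ -z` gives the smallest
zero `b - y` in the same way.

The Laguerre derivative formulas show that on level `s` the derivative of `levelFun` is `G z / x`,
where `G z = (1 - s) z + s (b + a s) / z` is odd (`hasDerivAt_levelFun`). Both extreme zeros are
positive, so the logarithmic derivative of their product in `s` is `1 / G Y - 1 / G y`. Since `G y -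
G Y = (y - Y) ((1 - s) - s (b + a s) / (Y y))`, it is enough that `Y < y` (`IsTopSol.lt_of_gap`) and
`s (b + a s) < (1 - s) Y y` (`slope_inequality`). The latter follows from the bounds `a s ≤ Y (Y +
2)`, `a s ≤ y (y - 2)` and `2n < y`, all read off the recurrence. -/

theorem laguerreHat_coeff {α : ℝ} (hα : -1 < α) (k d : ℕ) :
    (laguerreHat α (k + d)).coeff k =
      (-1) ^ d * (k + d).factorial * Real.Gamma (α + 1 + (k + d : ℕ)) /
        (k.factorial * d.factorial * Real.Gamma (α + 1 + k)) := by
  have hs : 0 < α + 1 + k := by have : (0 : ℝ) ≤ k := k.cast_nonneg; linarith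
  have h := choose_mul_gamma hs d
  have e1 : α + 1 + (k : ℝ) + d - 1 = ((k + d : ℕ) : ℝ) + α := by push_cast; ring
  have e2 : α + 1 + (k : ℝ) + d = α + 1 + ((k + d : ℕ) : ℝ) := by push_cast; ring
  rw [e1, e2] at h
  have hG := (Real.Gamma_pos_of_pos hs).ne'
  rw [laguerreHat, coeff_C_mul, laguerreL_coeff, if_pos (Nat.le_add_right _ _),
    Nat.add_sub_cancel_left]
  have e3 : ((-1 : ℝ)) ^ (k + d) * (-1) ^ k = (-1) ^ d := by
    rw [pow_add, mul_right_comm, ← mul_pow]; simp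
  rw [(eq_div_iff hG).2 h, ← e3]
  have := Nat.factorial_ne_zero k
  have := Nat.factorial_ne_zero d
  field_simp

theorem laguerreHat_coeff_of_lt (α : ℝ) {n k : ℕ} (h : n < k) :
    (laguerreHat α n).coeff k = 0 := by
  rw [laguerreHat, coeff_C_mul, laguerreL_coeff, if_neg (by omega), mul_zero]

theorem laguerreHat_zero (α : ℝ) : laguerreHat α 0 = 1 := by
  simp [laguerreHat, laguerreL]

theorem laguerreHat_one (α : ℝ) : laguerreHat α 1 = X - C (α + 1) := by
  simp [laguerreHat, laguerreL, Finset.sum_range_succ]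
  ring

theorem gamma_shift {α : ℝ} (hα : -1 < α) (k : ℕ) :
    Real.Gamma (α + 1 + (k + 1 : ℕ)) = (α + 1 + k) * Real.Gamma (α + 1 + k) := by
  have hs : 0 < α + 1 + k := by have : (0 : ℝ) ≤ k := k.cast_nonneg; linarith
  rw [← Real.Gamma_add_one hs.ne']; push_cast; ring_nf

theorem laguerreHat_add_two {α : ℝ} (hα : -1 < α) (n : ℕ) :
    laguerreHat α (n + 2) =
      (X - C (2 * ((n + 1 : ℕ) : ℝ) + α + 1)) * laguerreHat α (n + 1)
        - C (((n + 1 : ℕ) : ℝ) * ((n + 1 : ℕ) + α)) * laguerreHat α n := by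
  have hG : ∀ k : ℕ, Real.Gamma (α + 1 + k) ≠ 0 := fun k =>
    (Real.Gamma_pos_of_pos (by have : (0 : ℝ) ≤ k := k.cast_nonneg; linarith)).ne'
  have hp : ∀ k : ℕ, α + 1 + (k : ℝ) ≠ 0 := fun k => by
    have : (0 : ℝ) ≤ k := k.cast_nonneg
    linarith
  have hf : ∀ k : ℕ, (k.factorial : ℝ) ≠ 0 := fun k => by exact_mod_cast k.factorial_ne_zero
  ext j
  rw [sub_mul, coeff_sub, coeff_sub, coeff_C_mul, coeff_C_mul]
  rcases j with _ | i
  · have h0 := laguerreHat_coeff hα 0 n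
    have h1 := laguerreHat_coeff hα 0 (n + 1)
    have h2 := laguerreHat_coeff hα 0 (n + 2)
    rw [zero_add] at h0 h1 h2
    rw [coeff_X_mul_zero, h0, h1, h2, gamma_shift hα (n + 1), gamma_shift hα n,
      Nat.factorial_succ (n + 1), Nat.factorial_succ n]
    have := hG n
    have := hG 0
    have := hf n
    push_cast
    field_simp
    ring
  rw [coeff_X_mul]
  -- For `i < n` all four coefficients are given by the closed form; from `i = n` on, some of them
  -- lie above the degree and vanish.
  rcases lt_trichotomy i n with h | h | h
  · obtain ⟨d, rfl⟩ := Nat.exists_eq_add_of_lt h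
    have h0 := laguerreHat_coeff hα (i + 1) d
    have h1 := laguerreHat_coeff hα (i + 1) (d + 1)
    have h1' := laguerreHat_coeff hα i (d + 2)
    have h2 := laguerreHat_coeff hα (i + 1) (d + 2)
    have e0 : i + 1 + d = i + d + 1 := by ring
    have e1 : i + 1 + (d + 1) = i + d + 2 := by ring
    have e1' : i + (d + 2) = i + d + 2 := by ring
    have e2 : i + 1 + (d + 2) = i + d + 3 := by ring
    rw [e0] at h0; rw [e1] at h1; rw [e1'] at h1'; rw [e2] at h2
    rw [h0, h1, h1', h2]
    simp only [gamma_shift hα, Nat.factorial_succ]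
    have := hG i
    have := hG (i + d)
    have := hf i
    have := hf d
    have := hf (i + d)
    have := hp i
    push_cast
    field_simp
    ring
  · subst h
    have h1 := laguerreHat_coeff hα (i + 1) 0
    have h1' := laguerreHat_coeff hα i 1
    have h2 := laguerreHat_coeff hα (i + 1) 1
    rw [laguerreHat_coeff_of_lt α (Nat.lt_succ_self i)]
    rw [add_zero] at h1
    rw [h1, h1', h2]
    simp only [gamma_shift hα, Nat.factorial_succ]
    have := hG i
    have := hf i
    have := hp i
    have := hp (i + 1)
    push_cast at *
    field_simp
    ring
  · rw [laguerreHat_coeff_of_lt α (show n < i + 1 by omega),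
      laguerreHat_coeff_of_lt α (show n + 1 < i + 1 by omega)]
    rcases Nat.lt_or_ge (n + 1) i with h' | h'
    · rw [laguerreHat_coeff_of_lt α (show n + 2 < i + 1 by omega),
        laguerreHat_coeff_of_lt α h']
      simp
    · obtain rfl : i = n + 1 := by omega
      have h1 := laguerreHat_coeff hα (n + 1) 0
      have h2 := laguerreHat_coeff hα (n + 2) 0
      rw [add_zero] at h1 h2
      rw [h1, h2]
      have := hG (n + 1)
      have := hG (n + 2)
      have := hf (n + 1)
      have := hf (n + 2)
      field_simp
      simp

/-! ### Sequences given by a three-term recurrence -/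

/-- The sequence `P 0 = 1`, `P 1 = y - β 0`, `P (k + 2) = (y - β (k+1)) P (k+1) - a (k+1) P k`. -/
def recSeq {R : Type*} [CommRing R] (β a : ℕ → R) (y : R) : ℕ → R
  | 0 => 1
  | 1 => y - β 0
  | k + 2 => (y - β (k + 1)) * recSeq β a y (k + 1) - a (k + 1) * recSeq β a y k

theorem recSeq_add_two {R : Type*} [CommRing R] (β a : ℕ → R) (y : R) (k : ℕ) :
    recSeq β a y (k + 2) =
      (y - β (k + 1)) * recSeq β a y (k + 1) - a (k + 1) * recSeq β a y k := rfl

/-- Transports the recurrence from `ℝ[X]` to its values in `ℝ` and `ℂ`. -/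
theorem map_recSeq {R S : Type*} [CommRing R] [CommRing S] (f : R →+* S) (β a : ℕ → R) (y : R)
    (k : ℕ) : f (recSeq β a y k) = recSeq (fun i => f (β i)) (fun i => f (a i)) (f y) k := by
  induction k using Nat.twoStepInduction with
  | zero => simp [recSeq]
  | one => simp [recSeq]
  | more k h0 h1 => simp [recSeq_add_two, h0, h1]

theorem recSeq_shift {R : Type*} [CommRing R] (β a : ℕ → R) (y c : R) (k : ℕ) :
    recSeq (fun i => β i - c) a (y - c) k = recSeq β a y k := by
  induction k using Nat.twoStepInduction with
  | zero => rfl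
  | one => simp [recSeq]
  | more k h0 h1 => rw [recSeq_add_two, recSeq_add_two, h0, h1]; ring

theorem recSeq_reflect {R : Type*} [CommRing R] (β a : ℕ → R) (y c : R) (k : ℕ) :
    recSeq (fun i => c - β i) a (c - y) k = (-1) ^ k * recSeq β a y k := by
  induction k using Nat.twoStepInduction with
  | zero => simp [recSeq]
  | one => simp [recSeq]
  | more k h0 h1 => rw [recSeq_add_two, recSeq_add_two, h0, h1]; ring

theorem continuous_recSeq (β a : ℕ → ℝ) (k : ℕ) : Continuous fun y => recSeq β a y k := by
  induction k using Nat.twoStepInduction with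
  | zero => exact continuous_const
  | one => exact continuous_id.sub continuous_const
  | more k h0 h1 => simp only [recSeq_add_two]; fun_prop

/-- The inverse of a point of the upper half-plane lies in the lower one, so subtracting `A / r`
cannot lower the imaginary part. -/
theorem im_sub_div_pos {z r : ℂ} {b A : ℝ} (hz : 0 < z.im) (hr : 0 < r.im) (hA : 0 ≤ A) :
    0 < (z - b - A / r).im := by
  have h : ((A : ℂ) / r).im = - (A * r.im / Complex.normSq r) := by
    simp [Complex.div_im]
  rw [Complex.sub_im, Complex.sub_im, Complex.ofReal_im, h]
  have : 0 ≤ A * r.im / Complex.normSq r :=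
    div_nonneg (mul_nonneg hA hr.le) (Complex.normSq_nonneg r)
  linarith

/-- In the upper half plane the ratios of a real three-term recurrence have positive imaginary
part. -/
theorem recSeq_ratio_im_pos {β a : ℕ → ℝ} (ha : ∀ k, 0 ≤ a k) {z : ℂ} (hz : 0 < z.im) (k : ℕ) :
    recSeq (fun i => (β i : ℂ)) (fun i => (a i : ℂ)) z k ≠ 0 ∧
      0 < (recSeq (fun i => (β i : ℂ)) (fun i => (a i : ℂ)) z (k + 1) /
        recSeq (fun i => (β i : ℂ)) (fun i => (a i : ℂ)) z k).im := by
  induction k with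
  | zero => simpa [recSeq] using hz
  | succ k ih =>
    obtain ⟨h0, h1⟩ := ih
    set P := recSeq (fun i => (β i : ℂ)) (fun i => (a i : ℂ)) z
    have hne : P (k + 1) ≠ 0 := by
      intro h
      rw [h] at h1
      simp at h1
    refine ⟨hne, ?_⟩
    have := im_sub_div_pos (b := β (k + 1)) hz h1 (ha (k + 1))
    convert this using 2
    change ((z - β (k + 1)) * P (k + 1) - a (k + 1) * P k) / P (k + 1) = _
    field_simp

/-- Comparison of two three-term recurrences with the same off-diagonal coefficients. -/
theorem recSeq_compare {β β' a : ℕ → ℝ} (ha : ∀ k, 0 ≤ a k) {y y' d : ℝ} (hd : 0 ≤ d) {m : ℕ}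
    (hβ : ∀ k ≤ m, y - β k + d ≤ y' - β' k) (hpos : ∀ k ≤ m, 0 < recSeq β a y k) :
    ∀ k ≤ m, 0 < recSeq β' a y' k ∧
      recSeq β a y (k + 1) / recSeq β a y k + d ≤
        recSeq β' a y' (k + 1) / recSeq β' a y' k := by
  intro k
  induction k with
  | zero => intro _; simpa [recSeq] using hβ 0 (Nat.zero_le _)
  | succ k ih =>
    intro hk
    obtain ⟨h0, h1⟩ := ih (by omega)
    set P := recSeq β a y with hP
    set Q := recSeq β' a y' with hQ
    have p0 := hpos k (by omega)
    have p1 := hpos (k + 1) hk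
    have r1 : 0 < P (k + 1) / P k := div_pos p1 p0
    have q1' : 0 < Q (k + 1) / Q k := by linarith
    have q1 : 0 < Q (k + 1) := (div_pos_iff_of_pos_right h0).1 q1'
    refine ⟨q1, ?_⟩
    -- Consecutive ratios are linked by `r ↦ y - β - a / r`, which is increasing for `r > 0`; hence
    -- the gap `d` persists.
    have e1 : P (k + 1 + 1) / P (k + 1) = y - β (k + 1) - a (k + 1) / (P (k + 1) / P k) := by
      change ((y - β (k + 1)) * P (k + 1) - a (k + 1) * P k) / P (k + 1) = _
      field_simp
    have e2 : Q (k + 1 + 1) / Q (k + 1) = y' - β' (k + 1) - a (k + 1) / (Q (k + 1) / Q k) := by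
      change ((y' - β' (k + 1)) * Q (k + 1) - a (k + 1) * Q k) / Q (k + 1) = _
      field_simp
    have := hβ (k + 1) hk
    have : a (k + 1) / (Q (k + 1) / Q k) ≤ a (k + 1) / (P (k + 1) / P k) :=
      div_le_div_of_nonneg_left (ha _) r1 (by linarith)
    rw [e1, e2]
    linarith

theorem recSeq_mono {β a : ℕ → ℝ} (ha : ∀ k, 0 ≤ a k) {y y' : ℝ} (h : y ≤ y') {m : ℕ}
    (hpos : ∀ k ≤ m, 0 < recSeq β a y k) :
    ∀ k ≤ m, 0 < recSeq β a y' k ∧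
      recSeq β a y (k + 1) / recSeq β a y k + (y' - y) ≤
        recSeq β a y' (k + 1) / recSeq β a y' k :=
  recSeq_compare ha (sub_nonneg.2 h) (fun k _ => by linarith) hpos

/-- The largest zero of `P (m + 1)`: all previous terms are positive there. -/
theorem exists_top_zero {β a : ℕ → ℝ} (ha : ∀ k, 0 ≤ a k) (ha' : ∀ k, 0 < a (k + 1)) (m : ℕ) :
    ∃ u, recSeq β a u (m + 1) = 0 ∧ ∀ k ≤ m, 0 < recSeq β a u k := by
  induction m with
  | zero => exact ⟨β 0, by simp [recSeq], fun k hk => by simp [Nat.le_zero.1 hk, recSeq]⟩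
  | succ m ih =>
    obtain ⟨u, hu, hpos⟩ := ih
    -- Beyond `u + 1` the term `P (m + 1)` dominates `P m`, and `w - β (m + 1) ≥ a (m + 1)` then
    -- makes `P (m + 2)` nonnegative at `w`.
    set w := max (u + 1) (β (m + 1) + a (m + 1)) with hw
    have huw : u + 1 ≤ w := le_max_left _ _
    have hbw : β (m + 1) + a (m + 1) ≤ w := le_max_right _ _
    have key : ∀ y, u ≤ y → 0 < recSeq β a y m ∧ (y - u) * recSeq β a y m ≤ recSeq β a y (m + 1) := by
      intro y hy
      obtain ⟨h0, h1⟩ := recSeq_mono ha hy hpos m le_rfl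
      rw [hu, zero_div, zero_add, le_div_iff₀ h0] at h1
      exact ⟨h0, h1⟩
    have hlo : recSeq β a u (m + 2) ≤ 0 := by
      rw [recSeq_add_two, hu]
      linarith [mul_nonneg (ha (m + 1)) (hpos m le_rfl).le]
    have hhi : 0 ≤ recSeq β a w (m + 2) := by
      obtain ⟨h0, h1⟩ := key w (by linarith)
      rw [recSeq_add_two]
      have h2 : recSeq β a w m ≤ recSeq β a w (m + 1) := by nlinarith
      have h3 : a (m + 1) * recSeq β a w m ≤ a (m + 1) * recSeq β a w (m + 1) :=
        mul_le_mul_of_nonneg_left h2 (ha _)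
      nlinarith [mul_nonneg (show 0 ≤ w - β (m + 1) - a (m + 1) by linarith) (h0.le.trans h2)]
    obtain ⟨v, hv, hv0⟩ := intermediate_value_Icc (by linarith : u ≤ w)
      (continuous_recSeq β a (m + 2)).continuousOn ⟨hlo, hhi⟩
    refine ⟨v, hv0, fun k hk => ?_⟩
    rcases Nat.le_succ_iff.1 hk with hk | rfl
    · exact (recSeq_mono ha hv.1 hpos k hk).1
    · obtain ⟨h0, h1⟩ := key v hv.1
      rcases hv.1.eq_or_lt with rfl | hlt
      · exfalso
        have hv0 : recSeq β a u (m + 2) = 0 := hv0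
        rw [recSeq_add_two, hu] at hv0
        linarith [mul_pos (ha' m) h0]
      · exact lt_of_lt_of_le (mul_pos (sub_pos.2 hlt) h0) h1

/-- `ρ` is the largest solution of `y * P (m + 1) = A * P m`, located beyond the zeros of the
`P k`, `k ≤ m`. -/
structure IsTopSol (β a : ℕ → ℝ) (m : ℕ) (A ρ : ℝ) : Prop where
  nonneg : 0 ≤ ρ
  pos : ∀ k ≤ m, 0 < recSeq β a ρ k
  last_nonneg : 0 ≤ recSeq β a ρ (m + 1)
  eq : ρ * recSeq β a ρ (m + 1) = A * recSeq β a ρ m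

namespace IsTopSol

variable {β a : ℕ → ℝ} {m : ℕ} {A A' ρ ρ' : ℝ}

theorem ratio_nonneg (h : IsTopSol β a m A ρ) :
    0 ≤ recSeq β a ρ (m + 1) / recSeq β a ρ m :=
  div_nonneg h.last_nonneg (h.pos m le_rfl).le

theorem mul_ratio (h : IsTopSol β a m A ρ) :
    ρ * (recSeq β a ρ (m + 1) / recSeq β a ρ m) = A := by
  rw [← mul_div_assoc, h.eq, mul_div_cancel_right₀ _ (h.pos m le_rfl).ne']

/-- The ratio gains at least `z - ρ` between `ρ` and `z`, and so does the factor in front. The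
quadratic gain yields both maximality of `ρ` and Hölder continuity of `ρ` in `A`. -/
theorem add_sq_le (h : IsTopSol β a m A ρ) (ha : ∀ k, 0 ≤ a k) {z : ℝ} (hz : ρ ≤ z) :
    A + (z - ρ) ^ 2 ≤ z * (recSeq β a z (m + 1) / recSeq β a z m) := by
  have h1 := (recSeq_mono ha hz h.pos m le_rfl).2
  have h2 := h.mul_ratio
  have h3 := h.ratio_nonneg
  have h4 := h.nonneg
  have h5 : z * (recSeq β a ρ (m + 1) / recSeq β a ρ m + (z - ρ)) ≤
      z * (recSeq β a z (m + 1) / recSeq β a z m) :=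
    mul_le_mul_of_nonneg_left h1 (h4.trans hz)
  nlinarith [mul_nonneg (sub_nonneg.2 hz) h3, mul_nonneg (sub_nonneg.2 hz) h4]

theorem le_of_eq (h : IsTopSol β a m A ρ) (ha : ∀ k, 0 ≤ a k) {z : ℝ}
    (hz : z * recSeq β a z (m + 1) = A * recSeq β a z m) : z ≤ ρ := by
  by_contra! hlt
  have h1 := h.add_sq_le ha hlt.le
  have h0 := (recSeq_mono ha hlt.le h.pos m le_rfl).1
  rw [← mul_div_assoc, hz, mul_div_cancel_right₀ _ h0.ne'] at h1
  nlinarith [pow_pos (sub_pos.2 hlt) 2]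

theorem sq_le (h : IsTopSol β a m A ρ) (h' : IsTopSol β a m A' ρ') (ha : ∀ k, 0 ≤ a k)
    (hA : A ≤ A') : ρ ≤ ρ' ∧ (ρ' - ρ) ^ 2 ≤ A' - A := by
  rcases le_total ρ ρ' with hle | hle
  · have h1 := h.add_sq_le ha hle
    rw [h'.mul_ratio] at h1
    exact ⟨hle, by linarith⟩
  · have h1 := h'.add_sq_le ha hle
    rw [h.mul_ratio] at h1
    have : ρ = ρ' := by nlinarith [sq_nonneg (ρ - ρ')]
    subst this
    exact ⟨le_rfl, by simpa using hA⟩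

/-- Dropping the nonnegative term `a m * P (m - 1)` from the recurrence bounds the last ratio by `ρ
- β m`. -/
theorem le_mul_sub (h : IsTopSol β a m A ρ) (ha : ∀ k, 0 ≤ a k) (hm : 1 ≤ m) :
    A ≤ ρ * (ρ - β m) := by
  obtain ⟨k, rfl⟩ := Nat.exists_eq_add_of_le' hm
  have h0 := h.pos (k + 1) le_rfl
  have h1 := h.pos k (by omega)
  have h2 : recSeq β a ρ (k + 1 + 1) / recSeq β a ρ (k + 1) ≤ ρ - β (k + 1) := by
    rw [div_le_iff₀ h0, recSeq_add_two]
    linarith [mul_nonneg (ha (k + 1)) h1.le]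
  rw [← h.mul_ratio]
  exact mul_le_mul_of_nonneg_left h2 h.nonneg

theorem lt_of_one_le (h : IsTopSol β a m A ρ) (hm : 1 ≤ m) : β 0 < ρ :=
  sub_pos.1 (h.pos 1 hm)

/-- If `ρ' ≤ ρ`, the ratio for `β` at `ρ` would exceed the one for `β'` at `ρ'` by `d`, and the two
products could not both equal `A`. -/
theorem lt_of_gap {β' : ℕ → ℝ} (h : IsTopSol β a m A ρ) (h' : IsTopSol β' a m A ρ')
    (ha : ∀ k, 0 ≤ a k) (hρ' : 0 < ρ') {d : ℝ} (hd : 0 < d) (hβ : ∀ k ≤ m, β k + d ≤ β' k) :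
    ρ < ρ' := by
  by_contra! hle
  have h1 := (recSeq_compare (β := β') (β' := β) (y := ρ') (y' := ρ) ha hd.le
    (fun k hk => by linarith [hβ k hk]) h'.pos m le_rfl).2
  have h2 := h'.mul_ratio
  have h3 := h.mul_ratio
  have h4 := h'.ratio_nonneg
  have h5 := mul_le_mul hle h1 (by linarith) h.nonneg
  nlinarith [mul_pos hρ' hd]

end IsTopSol

theorem exists_isTopSol {β a : ℕ → ℝ} (ha : ∀ k, 0 ≤ a k) (ha' : ∀ k, 0 < a (k + 1)) (m : ℕ)
    {A : ℝ} (hA : 0 ≤ A) : ∃ ρ, IsTopSol β a m A ρ := by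
  obtain ⟨u, hu, hpos⟩ := exists_top_zero (β := β) ha ha' m
  have key : ∀ y, u ≤ y →
      0 < recSeq β a y m ∧ (y - u) * recSeq β a y m ≤ recSeq β a y (m + 1) := by
    intro y hy
    obtain ⟨h0, h1⟩ := recSeq_mono ha hy hpos m le_rfl
    rw [hu, zero_div, zero_add, le_div_iff₀ h0] at h1
    exact ⟨h0, h1⟩
  set v := max u 0 with hv
  have huv : u ≤ v := le_max_left _ _
  have hv0 : 0 ≤ v := le_max_right _ _
  have hcont : Continuous fun y => y * recSeq β a y (m + 1) - A * recSeq β a y m :=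
    (continuous_id.mul (continuous_recSeq β a _)).sub (continuous_const.mul (continuous_recSeq β a _))
  -- Whichever of `u` and `0` is the maximum, the first product vanishes there.
  have hlo : v * recSeq β a v (m + 1) - A * recSeq β a v m ≤ 0 := by
    have h0 := mul_nonneg hA (key v huv).1.le
    rcases max_choice u 0 with h | h
    · have : v = u := h
      rw [this] at h0 ⊢
      rw [hu]; linarith
    · have : v = 0 := h
      rw [this] at h0 ⊢
      linarith
  have hhi : 0 ≤ (v + A + 1) * recSeq β a (v + A + 1) (m + 1) -
      A * recSeq β a (v + A + 1) m := by
    obtain ⟨h0, h1⟩ := key (v + A + 1) (by linarith)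
    have h2 : recSeq β a (v + A + 1) m ≤ recSeq β a (v + A + 1) (m + 1) := by
      nlinarith [mul_nonneg (show 0 ≤ v + A + 1 - u - 1 by linarith) h0.le]
    have h3 := mul_le_mul (show A ≤ v + A + 1 by linarith) h2 h0.le (by linarith)
    linarith
  obtain ⟨ρ, hρ, hρ0⟩ := intermediate_value_Icc (by linarith : v ≤ v + A + 1)
    hcont.continuousOn ⟨hlo, hhi⟩
  obtain ⟨h0, h1⟩ := key ρ (huv.trans hρ.1)
  exact ⟨ρ, hv0.trans hρ.1, fun k hk => (recSeq_mono ha (huv.trans hρ.1) hpos k hk).1,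
    (mul_nonneg (sub_nonneg.2 (huv.trans hρ.1)) h0.le).trans h1, sub_eq_zero.1 hρ0⟩

/-! ### The Laguerre recurrence evaluated at points -/

/-- Diagonal recurrence coefficients of the monic Laguerre polynomials. -/
def lagB (α : ℝ) (k : ℕ) : ℝ := 2 * (k : ℝ) + α + 1

/-- Off-diagonal recurrence coefficients of the monic Laguerre polynomials. -/
def lagA (α : ℝ) (k : ℕ) : ℝ := (k : ℝ) * ((k : ℝ) + α)

theorem lagA_succ_pos {α : ℝ} (hα : -1 < α) (k : ℕ) : 0 < lagA α (k + 1) := by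
  have : (0 : ℝ) ≤ k := k.cast_nonneg
  rw [lagA]; push_cast
  exact mul_pos (by linarith) (by linarith)

theorem lagA_nonneg {α : ℝ} (hα : -1 < α) : ∀ k, 0 ≤ lagA α k
  | 0 => by simp [lagA]
  | k + 1 => (lagA_succ_pos hα k).le

theorem laguerreHat_eq_recSeq {α : ℝ} (hα : -1 < α) (k : ℕ) :
    laguerreHat α k = recSeq (fun i => C (lagB α i)) (fun i => C (lagA α i)) X k := by
  induction k using Nat.twoStepInduction with
  | zero => exact laguerreHat_zero α
  | one => rw [laguerreHat_one]; simp [recSeq, lagB]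
  | more k h0 h1 => rw [recSeq_add_two, ← h0, ← h1, laguerreHat_add_two hα]; rfl

theorem eval_laguerreHat {α : ℝ} (hα : -1 < α) (k : ℕ) (x : ℝ) :
    (laguerreHat α k).eval x = recSeq (lagB α) (lagA α) x k := by
  rw [laguerreHat_eq_recSeq hα, ← coe_evalRingHom, map_recSeq]
  simp

theorem isRoot_laguerreInterp (α : ℝ) (m : ℕ) (t x : ℝ) :
    (laguerreInterp α (m + 1) t).IsRoot x ↔
      (x - lagB α (m + 1)) * (laguerreHat α (m + 1)).eval x =
        lagA α (m + 1) * t ^ 2 * (laguerreHat α m).eval x := by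
  rw [IsRoot.def, ← sub_eq_zero (b := _ * _ * _)]
  simp [laguerreInterp, lagA, lagB]

theorem aeval_laguerreInterp_ne_zero {α : ℝ} (hα : -1 < α) (m : ℕ) (t : ℝ) {z : ℂ}
    (hz : 0 < z.im) : aeval z (laguerreInterp α (m + 1) t) ≠ 0 := by
  have hev : ∀ k, aeval z (laguerreHat α k) =
      recSeq (fun i => (lagB α i : ℂ)) (fun i => (lagA α i : ℂ)) z k := by
    intro k
    rw [laguerreHat_eq_recSeq hα]
    have := map_recSeq (aeval z : ℝ[X] →ₐ[ℝ] ℂ).toRingHom (fun i => C (lagB α i))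
      (fun i => C (lagA α i)) X k
    simpa using this
  obtain ⟨h0, h1⟩ := recSeq_ratio_im_pos (β := lagB α) (lagA_nonneg hα) hz m
  have h2 := (recSeq_ratio_im_pos (β := lagB α) (lagA_nonneg hα) hz (m + 1)).1
  have h3 := im_sub_div_pos (b := lagB α (m + 1)) hz h1
    (mul_nonneg (lagA_nonneg hα (m + 1)) (sq_nonneg t))
  intro h
  have h4 : aeval z (laguerreInterp α (m + 1) t) =
      (z - lagB α (m + 1)) * aeval z (laguerreHat α (m + 1)) -
        ((lagA α (m + 1) * t ^ 2 : ℝ) : ℂ) * aeval z (laguerreHat α m) := by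
    simp [laguerreInterp, lagA, lagB, Complex.ofReal_mul]
  rw [h4, hev, hev, sub_eq_zero] at h
  have h5 : z - lagB α (m + 1) - ((lagA α (m + 1) * t ^ 2 : ℝ) : ℂ) /
      (recSeq (fun i => (lagB α i : ℂ)) (fun i => (lagA α i : ℂ)) z (m + 1) /
        recSeq (fun i => (lagB α i : ℂ)) (fun i => (lagA α i : ℂ)) z m) = 0 := by
    rw [div_div_eq_mul_div, ← h, mul_div_cancel_right₀ _ h2, sub_self]
  rw [h5] at h3
  simp at h3

theorem laguerreInterp_splits {α : ℝ} (hα : -1 < α) (m : ℕ) (t : ℝ) :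
    (laguerreInterp α (m + 1) t).Splits := by
  refine Splits.of_splits_map (algebraMap ℝ ℂ) (IsAlgClosed.splits _) fun z hz => ?_
  have hz0 : aeval z (laguerreInterp α (m + 1) t) = 0 := by
    have := isRoot_of_mem_roots hz
    rwa [IsRoot.def, eval_map_algebraMap] at this
  refine ⟨z.re, Complex.ext (by simp) ?_⟩
  rcases lt_trichotomy z.im 0 with h | h | h
  · refine absurd ?_ (aeval_laguerreInterp_ne_zero hα m t
      (z := (starRingEnd ℂ) z) (by simpa using h))
    rw [aeval_conj, hz0, map_zero]
  · simp [h]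
  · exact absurd hz0 (aeval_laguerreInterp_ne_zero hα m t h)

/-! ### Extreme zeros -/

/-- Recurrence coefficients in the variable `x - (2n + α + 1)`. -/
def upB (α : ℝ) (n : ℕ) (k : ℕ) : ℝ := lagB α k - lagB α n

/-- Recurrence coefficients in the variable `(2n + α + 1) - x`. -/
def downB (α : ℝ) (n : ℕ) (k : ℕ) : ℝ := lagB α n - lagB α k

theorem recSeq_upB {α : ℝ} (hα : -1 < α) (n k : ℕ) (x : ℝ) :
    recSeq (upB α n) (lagA α) (x - lagB α n) k = (laguerreHat α k).eval x := by
  rw [eval_laguerreHat hα, ← recSeq_shift (lagB α) (lagA α) x (lagB α n)]; rfl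

theorem recSeq_downB {α : ℝ} (hα : -1 < α) (n k : ℕ) (x : ℝ) :
    recSeq (downB α n) (lagA α) (lagB α n - x) k = (-1) ^ k * (laguerreHat α k).eval x := by
  rw [eval_laguerreHat hα, ← recSeq_reflect (lagB α) (lagA α) x (lagB α n)]; rfl

theorem isRoot_iff_upB {α : ℝ} (hα : -1 < α) (m : ℕ) (t x : ℝ) :
    (laguerreInterp α (m + 1) t).IsRoot x ↔
      (x - lagB α (m + 1)) *
          recSeq (upB α (m + 1)) (lagA α) (x - lagB α (m + 1)) (m + 1) =
        lagA α (m + 1) * t ^ 2 * recSeq (upB α (m + 1)) (lagA α) (x - lagB α (m + 1)) m := by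
  rw [isRoot_laguerreInterp, recSeq_upB hα, recSeq_upB hα]

theorem isRoot_iff_downB {α : ℝ} (hα : -1 < α) (m : ℕ) (t x : ℝ) :
    (laguerreInterp α (m + 1) t).IsRoot x ↔
      (lagB α (m + 1) - x) *
          recSeq (downB α (m + 1)) (lagA α) (lagB α (m + 1) - x) (m + 1) =
        lagA α (m + 1) * t ^ 2 *
          recSeq (downB α (m + 1)) (lagA α) (lagB α (m + 1) - x) m := by
  rw [isRoot_laguerreInterp, recSeq_downB hα, recSeq_downB hα]
  have h : ((-1 : ℝ)) ^ m ≠ 0 := pow_ne_zero _ (by norm_num)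
  rw [← mul_right_inj' h]
  constructor <;> intro H <;> rw [pow_succ] at * <;> linear_combination H

theorem isGreatest_of_isTopSol {α : ℝ} (hα : -1 < α) {m : ℕ} {t Y : ℝ}
    (h : IsTopSol (upB α (m + 1)) (lagA α) m (lagA α (m + 1) * t ^ 2) Y) :
    IsGreatest {x : ℝ | (laguerreInterp α (m + 1) t).IsRoot x} (lagB α (m + 1) + Y) := by
  constructor
  · rw [Set.mem_ofPred_eq, isRoot_iff_upB hα, add_sub_cancel_left]
    exact h.eq
  · intro x hx
    have := h.le_of_eq (lagA_nonneg hα) ((isRoot_iff_upB hα m t x).1 hx)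
    linarith

theorem isLeast_of_isTopSol {α : ℝ} (hα : -1 < α) {m : ℕ} {t y : ℝ}
    (h : IsTopSol (downB α (m + 1)) (lagA α) m (lagA α (m + 1) * t ^ 2) y) :
    IsLeast {x : ℝ | (laguerreInterp α (m + 1) t).IsRoot x} (lagB α (m + 1) - y) := by
  constructor
  · rw [Set.mem_ofPred_eq, isRoot_iff_downB hα, sub_sub_cancel]
    exact h.eq
  · intro x hx
    have := h.le_of_eq (lagA_nonneg hα) ((isRoot_iff_downB hα m t x).1 hx)
    linarith

/-- This is the range `x = lagB α n - y ≤ 0`. As `lagA α (k + 1) = (k + 1) (k + 1 + α)`, the growth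
bound absorbs the off-diagonal term and reproduces itself. -/
theorem recSeq_downB_growth {α : ℝ} (hα : -1 < α) {n : ℕ} {y : ℝ} (hy : lagB α n ≤ y) (k : ℕ) :
    0 < recSeq (downB α n) (lagA α) y k ∧
      ((k : ℝ) + 1 + α) * recSeq (downB α n) (lagA α) y k ≤
        recSeq (downB α n) (lagA α) y (k + 1) := by
  induction k with
  | zero => simp [recSeq, downB, lagB] at *; linarith
  | succ k ih =>
    obtain ⟨h0, h1⟩ := ih
    have hk : (0 : ℝ) ≤ k := k.cast_nonneg
    have h2 : 0 < recSeq (downB α n) (lagA α) y (k + 1) :=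
      lt_of_lt_of_le (mul_pos (by linarith) h0) h1
    refine ⟨h2, ?_⟩
    rw [recSeq_add_two]
    have h3 : lagA α (k + 1) * recSeq (downB α n) (lagA α) y k ≤
        ((k : ℝ) + 1) * recSeq (downB α n) (lagA α) y (k + 1) := by
      have := mul_le_mul_of_nonneg_left h1 (show (0 : ℝ) ≤ k + 1 by linarith)
      rw [lagA]; push_cast; linarith
    have h4 : (2 * ((k : ℝ) + 1) + α + 1) * recSeq (downB α n) (lagA α) y (k + 1) ≤
        (y - downB α n (k + 1)) * recSeq (downB α n) (lagA α) y (k + 1) := by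
      refine mul_le_mul_of_nonneg_right ?_ h2.le
      have : downB α n (k + 1) = lagB α n - (2 * ((k : ℝ) + 1) + α + 1) := by
        simp [downB, lagB]
      linarith
    push_cast
    linarith

/-- Positivity of the smallest zero: otherwise the growth bound forces `y ≤ m + 1`, which is below
`lagB α (m + 1)`. -/
theorem isTopSol_downB_lt {α : ℝ} (hα : -1 < α) {m : ℕ} {s y : ℝ} (hs : s ≤ 1)
    (h : IsTopSol (downB α (m + 1)) (lagA α) m (lagA α (m + 1) * s) y) :
    y < lagB α (m + 1) := by
  by_contra! hy
  obtain ⟨h0, h1⟩ := recSeq_downB_growth hα hy m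
  have h2 := (recSeq_downB_growth hα hy (m + 1)).1
  have hm : (0 : ℝ) ≤ m := m.cast_nonneg
  have h3 : lagA α (m + 1) * s * recSeq (downB α (m + 1)) (lagA α) y m ≤
      ((m : ℝ) + 1) * recSeq (downB α (m + 1)) (lagA α) y (m + 1) := by
    have e1 := mul_le_mul_of_nonneg_left h1 (show (0 : ℝ) ≤ m + 1 by linarith)
    have e2 := mul_le_mul_of_nonneg_right hs (mul_pos (lagA_succ_pos hα m) h0).le
    have e3 : lagA α (m + 1) = ((m : ℝ) + 1) * ((m : ℝ) + 1 + α) := by rw [lagA]; push_cast; ring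
    rw [e3] at e2 ⊢
    linarith
  rw [← h.eq] at h3
  have h4 := le_of_mul_le_mul_right h3 h2
  rw [lagB] at hy
  push_cast at hy
  linarith

/-! ### The differential equations and the logarithmic derivative of the extreme zeros -/

/-- The two formulas need a joint induction: differentiating the recurrence uses both, and the
second at `k + 1` is the first at `k` combined with the recurrence. -/
theorem mul_derivative_laguerreHat {α : ℝ} (hα : -1 < α) (k : ℕ) (x : ℝ) :
    x * (derivative (laguerreHat α (k + 1))).eval x =
        ((k : ℝ) + 1) * (laguerreHat α (k + 1)).eval x +
          lagA α (k + 1) * (laguerreHat α k).eval x ∧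
      x * (derivative (laguerreHat α k)).eval x =
        (x - ((k : ℝ) + 1 + α)) * (laguerreHat α k).eval x - (laguerreHat α (k + 1)).eval x := by
  induction k with
  | zero =>
    rw [laguerreHat_one, laguerreHat_zero]
    simp [lagA]
    constructor <;> ring
  | succ k ih =>
    obtain ⟨h0, h1⟩ := ih
    have hM : (laguerreHat α (k + 2)).eval x =
        (x - lagB α (k + 1)) * (laguerreHat α (k + 1)).eval x -
          lagA α (k + 1) * (laguerreHat α k).eval x := by
      rw [laguerreHat_add_two hα]; simp [lagA, lagB]
    have hD : (derivative (laguerreHat α (k + 2))).eval x =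
        (laguerreHat α (k + 1)).eval x +
        (x - lagB α (k + 1)) * (derivative (laguerreHat α (k + 1))).eval x -
          lagA α (k + 1) * (derivative (laguerreHat α k)).eval x := by
      rw [laguerreHat_add_two hα, derivative_sub, derivative_mul, derivative_C_mul]
      simp [lagA, lagB]
    have ha : lagA α (k + 2) = lagA α (k + 1) + (2 * k + 3 + α) := by
      simp [lagA]; ring
    have hb : lagB α (k + 1) = 2 * k + 3 + α := by
      simp [lagB]; ring
    constructor
    · rw [hD, hM, ha, hb]
      push_cast
      linear_combination (x - (2 * k + 3 + α)) * h0 - lagA α (k + 1) * h1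
    · rw [hM, hb]
      push_cast
      linear_combination h0

/-- The function whose level sets are the zero sets of the interpolating polynomials. -/
def levelFun (α : ℝ) (m : ℕ) (x : ℝ) : ℝ :=
  (x - lagB α (m + 1)) * (laguerreHat α (m + 1)).eval x /
    (lagA α (m + 1) * (laguerreHat α m).eval x)

/-- The reciprocal of the logarithmic derivative of a zero with offset `z` with respect to
`s = t ^ 2`. -/
def logSlope (α : ℝ) (m : ℕ) (s z : ℝ) : ℝ :=
  (1 - s) * z + s * (lagB α (m + 1) + lagA α (m + 1) * s) / z

theorem hasDerivAt_levelFun {α : ℝ} (hα : -1 < α) {m : ℕ} {s x : ℝ} (hx : x ≠ 0)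
    (hz : x - lagB α (m + 1) ≠ 0) (hM : (laguerreHat α m).eval x ≠ 0)
    (hs : levelFun α m x = s) :
    HasDerivAt (levelFun α m) (logSlope α m s (x - lagB α (m + 1)) / x) x := by
  have ha := (lagA_succ_pos hα m).ne'
  have hd := (((hasDerivAt_id x).sub_const (lagB α (m + 1))).mul
    ((laguerreHat α (m + 1)).hasDerivAt x)).div
    (((laguerreHat α m).hasDerivAt x).const_mul (lagA α (m + 1))) (mul_ne_zero ha hM)
  refine hd.congr_deriv ?_
  obtain ⟨h0, h1⟩ := mul_derivative_laguerreHat hα m x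
  simp only [id, Pi.mul_apply, one_mul]
  rw [levelFun, div_eq_iff (mul_ne_zero ha hM)] at hs
  have e0 := eq_div_of_mul_eq hx ((mul_comm _ _).trans h0)
  have e1 := eq_div_of_mul_eq hx ((mul_comm _ _).trans h1)
  -- On the level set `M (m + 1)` is a multiple of `M m`, which then cancels from the derivative.
  have e2 := eq_div_of_mul_eq hz ((mul_comm _ _).trans hs)
  have hb : lagB α (m + 1) = 2 * m + 3 + α := by simp [lagB]; ring
  rw [e0, e1, e2, logSlope]
  have hz' : x = (x - lagB α (m + 1)) + (2 * m + 3 + α) := by rw [← hb]; ring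
  rw [hb] at hz ⊢
  field_simp
  ring

/-! ### Continuity and differentiability of the zero curves. -/

theorem continuousOn_of_sq_le {f : ℝ → ℝ} {a : ℝ} (ha : 0 < a)
    (h : ∀ s s', 0 ≤ s → s ≤ s' → (f s' - f s) ^ 2 ≤ a * (s' - s)) :
    ContinuousOn f (Set.Ici 0) := by
  have h' : ∀ s s', 0 ≤ s → 0 ≤ s' → (f s' - f s) ^ 2 ≤ a * |s' - s| := by
    intro s s' hs hs'
    rcases le_total s s' with hle | hle
    · rw [abs_of_nonneg (sub_nonneg.2 hle)]; exact h s s' hs hle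
    · rw [abs_of_nonpos (sub_nonpos.2 hle)]; linarith [h s' s hs' hle]
  intro s hs
  rw [Metric.continuousWithinAt_iff]
  intro ε hε
  refine ⟨ε ^ 2 / a, by positivity, fun s' hs' hd => ?_⟩
  rw [Real.dist_eq] at hd ⊢
  rw [lt_div_iff₀ ha] at hd
  have h1 := h' s s' hs hs'
  exact abs_lt_of_sq_lt_sq (by linarith) hε.le

/-- A continuous local right inverse of `levelFun` has the reciprocal derivative. -/
theorem hasDerivAt_zero_of_levelFun {α : ℝ} (hα : -1 < α) {m : ℕ} {f : ℝ → ℝ} {s : ℝ}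
    (hs : 0 < s) (hf : ContinuousOn f (Set.Ici 0))
    (hlev : ∀ σ, 0 < σ → levelFun α m (f σ) = σ) (hx : f s ≠ 0)
    (hz : f s - lagB α (m + 1) ≠ 0) (hM : (laguerreHat α m).eval (f s) ≠ 0)
    (hG : logSlope α m s (f s - lagB α (m + 1)) ≠ 0) :
    HasDerivAt f (f s / logSlope α m s (f s - lagB α (m + 1))) s := by
  have h := HasDerivAt.of_local_left_inverse (hf.continuousAt (Ici_mem_nhds hs))
    (hasDerivAt_levelFun hα hx hz hM (hlev s hs)) (div_ne_zero hG hx)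
    ((lt_mem_nhds hs).mono fun σ hσ => hlev σ hσ)
  rwa [inv_div] at h

/-! ### The inequality between the extreme zeros -/

theorem slope_inequality {α N s Y y : ℝ} (hα : -1 < α)
    (hN : N = 5 ∨ N = 6 ∨ 7 ≤ N) (hs : 0 < s) (hs' : s ≤ 0.3236) (hY : 0 ≤ Y)
    (hYA : N * (N + α) * s ≤ Y * (Y + 2)) (hyA : N * (N + α) * s ≤ y * (y - 2))
    (hy : 2 * N < y) :
    s * (2 * N + α + 1 + N * (N + α) * s) < (1 - s) * (Y * y) := by
  have hN5 : 5 ≤ N := by rcases hN with h | h | h <;> linarith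
  have ha : 0 < N * (N + α) := mul_pos (by linarith) (by linarith)
  set a := N * (N + α) with ha_def
  set w := Real.sqrt (1 + a * s) with hw
  have has : 0 < a * s := mul_pos ha hs
  have hw2 : w ^ 2 = 1 + a * s := Real.sq_sqrt (by linarith)
  have hw1 : 1 < w := by
    rw [hw]; exact Real.lt_sqrt_of_sq_lt (by linarith)
  have hYw : w - 1 ≤ Y := by
    have : w ≤ Y + 1 := Real.sqrt_le_iff.2 ⟨by linarith, by nlinarith⟩
    linarith
  have hyw : w + 1 ≤ y := by
    have : w ≤ y - 1 := Real.sqrt_le_iff.2 ⟨by linarith, by nlinarith⟩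
    linarith
  -- Here `0.3528 = 1 - 2 * 0.3236`: since `Y * y ≥ (w - 1) * (w + 1) = a * s`, it suffices that `2
  -- * N + α + 1 + a * s < (1 - s) * a`.
  have main : 2 * N + α + 1 < a * 0.3528 →
      s * (2 * N + α + 1 + a * s) < (1 - s) * (Y * y) := by
    intro hc
    have h1 : a * s ≤ Y * y := by
      have := mul_le_mul hYw hyw (by linarith) hY
      nlinarith
    have h2 : (1 - s) * (a * s) ≤ (1 - s) * (Y * y) :=
      mul_le_mul_of_nonneg_left h1 (by linarith)
    have h3 : 2 * N + α + 1 + a * s < (1 - s) * a := by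
      nlinarith [mul_nonneg ha.le (sub_nonneg.2 hs')]
    nlinarith [mul_lt_mul_of_pos_left h3 hs]
  by_cases h3 : 3 ≤ α
  · refine main ?_
    rw [ha_def]
    nlinarith [mul_nonneg (sub_nonneg.2 h3) (sub_nonneg.2 hN5)]
  by_cases h7 : 7 ≤ N
  · refine main ?_
    rw [ha_def]
    nlinarith [mul_nonneg (sub_nonneg.2 hα.le) (sub_nonneg.2 h7)]
  -- What remains is `N = 5, 6` with `α < 3`. Now `y > 2 * N ≥ 10` is the better bound: `a * s = (w
  -- + 1) * (w - 1) ≤ 5.31 * Y`, and `10 / 5.31 > 1.88`.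
  push Not at h3 h7
  have hN6 : N ≤ 6 := by rcases hN with h | h | h <;> linarith
  have ha54 : a ≤ 54 := by
    rw [ha_def]
    have := mul_le_mul hN6 (show N + α ≤ 9 by linarith) (by linarith) (by norm_num)
    linarith
  have hw4 : w ≤ 4.31 := by
    refine Real.sqrt_le_iff.2 ⟨by norm_num, ?_⟩
    have := mul_le_mul ha54 hs' hs.le (by norm_num)
    norm_num at this ⊢
    linarith
  have hYas : a * s ≤ 5.31 * Y := by
    have : a * s = (w + 1) * (w - 1) := by linear_combination -hw2
    rw [this]
    exact mul_le_mul (by linarith) hYw (by linarith) (by norm_num)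
  have hYy : 10 * Y ≤ Y * y := by nlinarith
  have hc : 2 * N + α + 1 < 0.94 * a := by
    rw [ha_def]
    nlinarith [mul_nonneg (show 0 ≤ α + 1 by linarith) (sub_nonneg.2 hN5)]
  have h1 : a * s * 1.88 ≤ Y * y := by linarith
  have h2 : (1 - s) * (a * s * 1.88) ≤ (1 - s) * (Y * y) :=
    mul_le_mul_of_nonneg_left h1 (by linarith)
  have h4 : 2 * N + α + 1 + a * s < (1 - s) * (1.88 * a) := by
    nlinarith [mul_nonneg ha.le (sub_nonneg.2 hs')]
  nlinarith [mul_lt_mul_of_pos_left h4 hs]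


theorem logSlope_lt {α : ℝ} (hα : -1 < α) {m : ℕ} (hm : 4 ≤ m) {s Y y : ℝ} (hs : 0 < s)
    (hs' : s ≤ 0.3236)
    (hY : IsTopSol (upB α (m + 1)) (lagA α) m (lagA α (m + 1) * s) Y)
    (hy : IsTopSol (downB α (m + 1)) (lagA α) m (lagA α (m + 1) * s) y) :
    0 < Y ∧ 0 < y ∧ 0 < logSlope α m s Y ∧ logSlope α m s Y < logSlope α m s y := by
  have ha := lagA_succ_pos hα m
  have hm' : (4 : ℝ) ≤ m := by exact_mod_cast hm
  have hY0 : 0 < Y := by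
    refine hY.nonneg.lt_of_ne fun h => ?_
    have h1 := hY.mul_ratio
    rw [← h, zero_mul] at h1
    exact (mul_pos ha hs).ne h1
  have e1 : upB α (m + 1) m = -2 := by simp [upB, lagB]; ring
  have e2 : downB α (m + 1) m = 2 := by simp [downB, lagB]; ring
  have e3 : downB α (m + 1) 0 = 2 * ((m : ℝ) + 1) := by simp [downB, lagB]
  have e4 : lagA α (m + 1) = ((m : ℝ) + 1) * ((m : ℝ) + 1 + α) := by simp [lagA]
  have e5 : lagB α (m + 1) = 2 * ((m : ℝ) + 1) + α + 1 := by simp [lagB]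
  have h1 := hY.le_mul_sub (lagA_nonneg hα) (by omega)
  have h2 := hy.le_mul_sub (lagA_nonneg hα) (by omega)
  have h3 := hy.lt_of_one_le (by omega)
  rw [e1, sub_neg_eq_add] at h1
  rw [e2] at h2
  rw [e3] at h3
  have hy0 : 0 < y := by linarith
  -- The diagonals are `∓2 (m + 1 - k)`, so they differ by at least 4 for `k ≤ m`; a gap of 2 is
  -- enough.
  have hlt : Y < y := hY.lt_of_gap hy (lagA_nonneg hα) hy0 two_pos fun k hk => by
    have hk' : (k : ℝ) ≤ m := by exact_mod_cast hk
    simp only [upB, downB, lagB]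
    push_cast
    linarith
  have hN : (m : ℝ) + 1 = 5 ∨ (m : ℝ) + 1 = 6 ∨ 7 ≤ (m : ℝ) + 1 := by
    have : m + 1 = 5 ∨ m + 1 = 6 ∨ 7 ≤ m + 1 := by omega
    exact_mod_cast this
  rw [e4] at h1 h2
  have key := slope_inequality hα hN hs hs' hY0.le h1 h2 h3
  rw [← e4, ← e5] at key
  set B := s * (lagB α (m + 1) + lagA α (m + 1) * s) with hB
  have hB0 : 0 < B := by
    refine mul_pos hs (add_pos ?_ (mul_pos ha hs))
    rw [e5]; linarith
  refine ⟨hY0, hy0, add_pos (mul_pos (by linarith) hY0) (div_pos hB0 hY0), ?_⟩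
  have hdiff : logSlope α m s y - logSlope α m s Y =
      (y - Y) * ((1 - s) * (Y * y) - B) / (Y * y) := by
    simp only [logSlope, ← hB]
    field_simp
    ring
  have : 0 < (y - Y) * ((1 - s) * (Y * y) - B) / (Y * y) :=
    div_pos (mul_pos (sub_pos.2 hlt) (sub_pos.2 key)) (mul_pos hY0 hy0)
  linarith

theorem levelFun_eq_of_upB {α : ℝ} (hα : -1 < α) {m : ℕ} {s Y : ℝ}
    (h : IsTopSol (upB α (m + 1)) (lagA α) m (lagA α (m + 1) * s) Y) :
    0 < (laguerreHat α m).eval (lagB α (m + 1) + Y) ∧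
      levelFun α m (lagB α (m + 1) + Y) = s := by
  have h0 := h.pos m le_rfl
  have h1 := h.eq
  have hY : Y = lagB α (m + 1) + Y - lagB α (m + 1) := by ring
  rw [hY, recSeq_upB hα] at h0 h1
  rw [recSeq_upB hα] at h1
  refine ⟨h0, ?_⟩
  rw [levelFun, div_eq_iff (mul_pos (lagA_succ_pos hα m) h0).ne', h1]
  ring

theorem levelFun_eq_of_downB {α : ℝ} (hα : -1 < α) {m : ℕ} {s y : ℝ}
    (h : IsTopSol (downB α (m + 1)) (lagA α) m (lagA α (m + 1) * s) y) :
    (laguerreHat α m).eval (lagB α (m + 1) - y) ≠ 0 ∧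
      levelFun α m (lagB α (m + 1) - y) = s := by
  have h0 := (h.pos m le_rfl).ne'
  have h1 := h.eq
  have hy : y = lagB α (m + 1) - (lagB α (m + 1) - y) := by ring
  rw [hy, recSeq_downB hα] at h0 h1
  rw [recSeq_downB hα] at h1
  have h2 := right_ne_zero_of_mul h0
  refine ⟨h2, ?_⟩
  rw [levelFun, div_eq_iff (mul_ne_zero (lagA_succ_pos hα m).ne' h2)]
  refine mul_left_cancel₀ (left_ne_zero_of_mul h0) ?_
  rw [pow_succ] at h1
  linear_combination h1

/-- With `s = t ^ 2`, the product of the extreme zeros increases with `s`. -/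
theorem strictMonoOn_mul_offsets {α : ℝ} (hα : -1 < α) {m : ℕ} (hm : 4 ≤ m) {Y y : ℝ → ℝ}
    (hY : ∀ s, 0 ≤ s → IsTopSol (upB α (m + 1)) (lagA α) m (lagA α (m + 1) * s) (Y s))
    (hy : ∀ s, 0 ≤ s → IsTopSol (downB α (m + 1)) (lagA α) m (lagA α (m + 1) * s) (y s)) :
    StrictMonoOn (fun s => (lagB α (m + 1) - y s) * (lagB α (m + 1) + Y s))
      (Set.Icc 0 0.3236) := by
  have ha := lagA_succ_pos hα m
  have hcY : ContinuousOn (fun s => lagB α (m + 1) + Y s) (Set.Ici 0) :=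
    continuousOn_of_sq_le ha fun s s' hs hss => by
      have := ((hY s hs).sq_le (hY s' (hs.trans hss)) (lagA_nonneg hα)
        (mul_le_mul_of_nonneg_left hss ha.le)).2
      linarith
  have hcy : ContinuousOn (fun s => lagB α (m + 1) - y s) (Set.Ici 0) :=
    continuousOn_of_sq_le ha fun s s' hs hss => by
      have := ((hy s hs).sq_le (hy s' (hs.trans hss)) (lagA_nonneg hα)
        (mul_le_mul_of_nonneg_left hss ha.le)).2
      linarith
  refine strictMonoOn_of_deriv_pos (convex_Icc _ _)
    ((hcy.mul hcY).mono fun s hs => hs.1) fun s hs => ?_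
  rw [interior_Icc] at hs
  have hs0 : 0 < s := hs.1
  obtain ⟨hY0, hy0, hG, hGG⟩ := logSlope_lt hα hm hs0 hs.2.le (hY s hs0.le) (hy s hs0.le)
  have hx0 : 0 < lagB α (m + 1) - y s :=
    sub_pos.2 (isTopSol_downB_lt hα (by linarith [hs.2]) (hy s hs0.le))
  have hx1 : 0 < lagB α (m + 1) + Y s := by linarith
  have hneg : logSlope α m s (-y s) = -logSlope α m s (y s) := by
    simp only [logSlope, div_neg]; ring
  have eY : lagB α (m + 1) + Y s - lagB α (m + 1) = Y s := by ring
  have ey : lagB α (m + 1) - y s - lagB α (m + 1) = -y s := by ring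
  have dY := hasDerivAt_zero_of_levelFun hα hs0 hcY
    (fun σ hσ => (levelFun_eq_of_upB hα (hY σ hσ.le)).2) hx1.ne' (by rw [eY]; exact hY0.ne')
    (levelFun_eq_of_upB hα (hY s hs0.le)).1.ne' (by rw [eY]; exact hG.ne')
  have dy := hasDerivAt_zero_of_levelFun hα hs0 hcy
    (fun σ hσ => (levelFun_eq_of_downB hα (hy σ hσ.le)).2) hx0.ne'
    (by rw [ey]; exact neg_ne_zero.2 hy0.ne')
    (levelFun_eq_of_downB hα (hy s hs0.le)).1
    (by rw [ey, hneg]; exact neg_ne_zero.2 (hG.trans hGG).ne')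
  rw [eY] at dY
  rw [ey, hneg] at dy
  have hd := (dy.mul dY).deriv
  change 0 < deriv ((fun s => lagB α (m + 1) - y s) * fun s => lagB α (m + 1) + Y s) s
  rw [hd]
  have hinv : 0 < 1 / logSlope α m s (Y s) - 1 / logSlope α m s (y s) :=
    sub_pos.2 (one_div_lt_one_div_of_lt hG hGG)
  have := mul_pos (mul_pos hx0 hx1) hinv
  rw [div_neg]
  refine this.trans_eq ?_
  ring

end

/-! ### Return from `s = t ^ 2` to `t`. -/

theorem proposition1 (α : ℝ) (hα : -1 < α) (hα' : α ≤ 47.9603) (n : ℕ) (hn : 5 ≤ n) :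
    (∀ t ∈ Set.Icc (0 : ℝ) 0.568774,
      (laguerreInterp α n t).Splits ∧
      IsLeast {x : ℝ | (laguerreInterp α n t).IsRoot x} (smallestZero (laguerreInterp α n t)) ∧
      IsGreatest {x : ℝ | (laguerreInterp α n t).IsRoot x}
        (largestZero (laguerreInterp α n t))) ∧
    StrictMonoOn
      (fun t : ℝ => smallestZero (laguerreInterp α n t) * largestZero (laguerreInterp α n t))
      (Set.Icc (0 : ℝ) 0.568774) := by
  obtain ⟨m, rfl⟩ := Nat.exists_eq_add_of_le' (show 1 ≤ n by omega)
  have hm : 4 ≤ m := by omega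
  have hex : ∀ β s, ∃ ρ, 0 ≤ s → IsTopSol β (lagA α) m (lagA α (m + 1) * s) ρ := by
    intro β s
    by_cases hs : 0 ≤ s
    · obtain ⟨ρ, hρ⟩ := exists_isTopSol (β := β) (lagA_nonneg hα) (lagA_succ_pos hα) m
        (mul_nonneg (lagA_nonneg hα (m + 1)) hs)
      exact ⟨ρ, fun _ => hρ⟩
    -- Dummy value for negative `s`, making `Y` and `y` total functions.
    · exact ⟨0, fun h => absurd h hs⟩
  choose Y hY using hex (upB α (m + 1))
  choose y hy using hex (downB α (m + 1))
  have hG := fun t : ℝ => isGreatest_of_isTopSol hα (hY (t ^ 2) (sq_nonneg t))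
  have hL := fun t : ℝ => isLeast_of_isTopSol hα (hy (t ^ 2) (sq_nonneg t))
  have eG : ∀ t, largestZero (laguerreInterp α (m + 1) t) = lagB α (m + 1) + Y (t ^ 2) :=
    fun t => (hG t).csSup_eq
  have eL : ∀ t, smallestZero (laguerreInterp α (m + 1) t) = lagB α (m + 1) - y (t ^ 2) :=
    fun t => (hL t).csInf_eq
  simp only [eG, eL]
  refine ⟨fun t _ => ⟨laguerreInterp_splits hα m t, hL t, hG t⟩, ?_⟩
  -- `0.568774 ^ 2` is about `0.32350`.
  have hmem : ∀ t ∈ Set.Icc (0 : ℝ) 0.568774, t ^ 2 ∈ Set.Icc (0 : ℝ) 0.3236 := by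
    intro t ht
    refine ⟨sq_nonneg t, (pow_le_pow_left₀ ht.1 ht.2 2).trans (by norm_num)⟩
  intro t ht t' ht' htt
  exact strictMonoOn_mul_offsets hα hm hY hy (hmem t ht) (hmem t' ht')
    (pow_lt_pow_left₀ htt ht.1 two_ne_zero)
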